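/- Let $(W_t)_{t\ge 0}$ be a standard Wiener process (with $W_0=0$ and continuous paths, almost surely) on a probability space $(\Omega,\mathcal F,\mathbb P)$, and let $M_t=\sup_{0\le s\le t}W_s$ and $m_t=\inf_{0\le s\le t}W_s$ be its running maximum and running minimum. Let $\Phi$ be the distribution function of the standard normal law $N(0,1)$ and put $$\Psi(q,r,s)=\sum_{k=0}^{\infty}\bigl(\Phi(q-ks)-\Phi(q-r-ks)\bigr),$$ a series that converges for all real $q,r$ and all $s>0$. Then for every $t>0$ the joint distribution function $F_t(x,y,z)=\mathbb P(W_t\le x,\ M_t\le y,\ m_t\le z)$ of $(W_t,M_t,m_t)$ satisfies, for all real $x,y,z$, $$F_t(x,y,z)=F\left(\frac{x}{\sqrt t},\frac{y}{\sqrt t},\frac{z}{\sqrt t}\right),$$ where $$F(x,y,z)=\begin{cases} 0 & \text{for } y\le 0,\\ \Phi(x)-\Phi(x-2y) & \text{for } z\ge 0,\ 0<y,\ x<y,\\ 2\Phi(y)-1 & \text{for } z\ge 0,\ 0<y\le x,\\ \Phi(x)-\Phi(x-2y) & \text{for } x<z<0<y,\\ 2\Psi(z,2y,2(y-z))-\Psi(x+2z-2y,2y,2(y-z))-\Psi(-x+2z,2y,2(y-z))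 & \text{for } z<0<y,\ z\le x\le y,\\ 2\Psi(z,2y,2(y-z))-2\Psi(2z-y,2y,2(y-z)) & \text{for } z<0<y<x. \end{cases}$$ -/

import Mathlib

open MeasureTheory ProbabilityTheory Set
open scoped NNReal

namespace WienerExtrema

/-- The distribution function of the standard normal law. -/
noncomputable def Phi (x : ℝ) : ℝ := cdf (gaussianReal 0 1) x

/-- The `k`-th term of the series `Psi q r s`. -/
noncomputable def psiTerm (q r s : ℝ) (k : ℕ) : ℝ := Phi (q - k * s) - Phi (q - r - k * s)

/-- `Ψ(q, r, s) = ∑_{k ≥ 0} (Φ(q - k s) - Φ(q - r - k s))`. -/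
noncomputable def Psi (q r s : ℝ) : ℝ := ∑' k : ℕ, psiTerm q r s k

/-- The piecewise function `F(x, y, z)`. The six branches are, in order: `y ≤ 0`;
`z ≥ 0`, `0 < y`, `x < y`; `z ≥ 0`, `0 < y ≤ x`; `x < z < 0 < y`;
`z < 0 < y`, `z ≤ x ≤ y`; `z < 0 < y < x`. -/
noncomputable def F (x y z : ℝ) : ℝ :=
  if y ≤ 0 then 0
  else if 0 ≤ z then
    if x < y then Phi x - Phi (x - 2 * y)
    else 2 * Phi y - 1
  else if x < z then Phi x - Phi (x - 2 * y)
  else if x ≤ y then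
    2 * Psi z (2 * y) (2 * (y - z))
      - Psi (x + 2 * z - 2 * y) (2 * y) (2 * (y - z))
      - Psi (-x + 2 * z) (2 * y) (2 * (y - z))
  else
    2 * Psi z (2 * y) (2 * (y - z)) - 2 * Psi (2 * z - y) (2 * y) (2 * (y - z))

variable {Ω : Type*}

/-- The running maximum `M_t = sup {W_s : 0 ≤ s ≤ t}`. -/
noncomputable def runMax (W : ℝ≥0 → Ω → ℝ) (t : ℝ≥0) (ω : Ω) : ℝ :=
  sSup ((fun s => W s ω) '' Icc 0 t)

/-- The running minimum `m_t = inf {W_s : 0 ≤ s ≤ t}`. -/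
noncomputable def runMin (W : ℝ≥0 → Ω → ℝ) (t : ℝ≥0) (ω : Ω) : ℝ :=
  sInf ((fun s => W s ω) '' Icc 0 t)

/-- The joint distribution function of `(W_t, M_t, m_t)`: the mass that the joint law of the
triple gives to `(-∞, x] × (-∞, y] × (-∞, z]`. -/
noncomputable def jointCDF [MeasurableSpace Ω] (W : ℝ≥0 → Ω → ℝ) (P : Measure Ω) (t : ℝ≥0)
    (x y z : ℝ) : ℝ :=
  (P.map (fun ω => (W t ω, runMax W t ω, runMin W t ω))).real (Iic x ×ˢ Iic y ×ˢ Iic z)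

end WienerExtrema

/-!
Let `g` be antisymmetric about every frontier point of an open set `U ∋ 0`. For a path that leaves
`U` at time `σ ≤ T`, the mean of `g (W_T)` given the past up to `σ` is the heat semigroup
`heat g (T - σ)` at the frontier point `W_σ`, which vanishes by antisymmetry. Hence only the paths
that stay in `U` contribute to `𝔼 g (W_T)`. Instead of the strong Markov property, `σ` is rounded up
to a finite grid, where independence of increments suffices, and the mesh tends to `0`.

With `g = 1_A - 1_B`, where `B` is the reflection of `A` and misses `U`, this gives
`ℙ(W_T ∈ A, path in U) = N(0, T)(A) - N(0, T)(B)`. The half-line `U = (-∞, y)` yields the law of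
`(W, M)`; for `U = (z, y)` the set `A` is `[z, x]` together with its translates by the multiples of
`2 (y - z)`, the translations generated by the two reflections, and the sum over the translates is
a combination of values of `Ψ`. Since `M` has no atom in `[0, ∞)`,
`ℙ(W ≤ x, M ≤ y, m ≤ z) = ℙ(W ≤ x, M < y) - ℙ(W ≤ x, M < y, z < m)` for `y > 0`. Brownian scaling
reduces everything to time `1`.
-/

namespace WienerExtrema

open Filter Topology
open scoped Pointwise

section Heat

theorem tendsto_integral_abs_sub_of_integral_eq {α ι : Type*} [MeasurableSpace α] {μ : Measure α}
    {l : Filter ι} [l.IsCountablyGenerated] {p : ι → α → ℝ} {q : α → ℝ}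
    (hp : ∀ᶠ i in l, Integrable (p i) μ) (hp0 : ∀ᶠ i in l, ∀ᵐ a ∂μ, 0 ≤ p i a)
    (hq : Integrable q μ) (heq : ∀ᶠ i in l, ∫ a, p i a ∂μ = ∫ a, q a ∂μ)
    (hlim : ∀ᵐ a ∂μ, Tendsto (p · a) l (𝓝 (q a))) :
    Tendsto (fun i => ∫ a, |p i a - q a| ∂μ) l (𝓝 0) := by
  have hpos : Tendsto (fun i => ∫ a, max (q a - p i a) 0 ∂μ) l (𝓝 (∫ _, 0 ∂μ)) := by
    refine tendsto_integral_filter_of_dominated_convergence (fun a => |q a|) ?_ ?_ hq.abs ?_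
    · filter_upwards [hp] with i hi using ((hq.sub hi).pos_part).aestronglyMeasurable
    · filter_upwards [hp0] with i hi
      filter_upwards [hi] with a ha
      rw [Real.norm_of_nonneg (le_max_right _ _)]
      exact max_le (by linarith [le_abs_self (q a)]) (abs_nonneg _)
    · filter_upwards [hlim] with a ha
      simpa using (ha.const_sub (q a)).max (tendsto_const_nhds (x := (0 : ℝ)))
  -- Both integrals agree, so the negative part of `p i - q` carries half of the total variation.
  have habs : ∀ᶠ i in l, 2 * ∫ a, max (q a - p i a) 0 ∂μ = ∫ a, |p i a - q a| ∂μ := by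
    filter_upwards [hp, heq] with i hi hi'
    have hsplit : ∀ a, |p i a - q a| = 2 * max (q a - p i a) 0 + (p i a - q a) := fun a => by
      rcases le_total (p i a) (q a) with h | h
      · rw [max_eq_left (sub_nonneg.2 h), abs_of_nonpos (sub_nonpos.2 h)]; ring
      · rw [max_eq_right (sub_nonpos.2 h), abs_of_nonneg (sub_nonneg.2 h)]; ring
    have hmax : Integrable (fun a => max (q a - p i a) 0) μ := (hq.sub hi).pos_part
    have hsub : Integrable (fun a => p i a - q a) μ := hi.sub hq
    simp only [hsplit]
    rw [integral_add (hmax.const_mul 2) hsub, integral_sub hi hq, hi',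
      sub_self, add_zero, integral_const_mul]
  simpa using (hpos.const_mul 2).congr' habs

theorem tendsto_integral_mul_of_integral_eq {α ι : Type*} [MeasurableSpace α] {μ : Measure α}
    {l : Filter ι} [l.IsCountablyGenerated] {p : ι → α → ℝ} {q g : α → ℝ} {C : ℝ}
    (hg : AEStronglyMeasurable g μ) (hC : ∀ a, |g a| ≤ C)
    (hp : ∀ᶠ i in l, Integrable (p i) μ) (hp0 : ∀ᶠ i in l, ∀ᵐ a ∂μ, 0 ≤ p i a)
    (hq : Integrable q μ) (heq : ∀ᶠ i in l, ∫ a, p i a ∂μ = ∫ a, q a ∂μ)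
    (hlim : ∀ᵐ a ∂μ, Tendsto (p · a) l (𝓝 (q a))) :
    Tendsto (fun i => ∫ a, p i a * g a ∂μ) l (𝓝 (∫ a, q a * g a ∂μ)) := by
  have hL1 := (tendsto_integral_abs_sub_of_integral_eq hp hp0 hq heq hlim).mul_const C
  rw [zero_mul] at hL1
  refine tendsto_iff_dist_tendsto_zero.2 (squeeze_zero' (.of_forall fun _ => dist_nonneg) ?_ hL1)
  have hgC : ∀ᵐ a ∂μ, ‖g a‖ ≤ C := ae_of_all _ hC
  filter_upwards [hp] with i hi
  rw [dist_eq_norm, ← integral_sub (hi.mul_bdd hg hgC) (hq.mul_bdd hg hgC), ← integral_mul_const]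
  refine norm_integral_le_of_norm_le ((hi.sub hq).abs.mul_const C) (ae_of_all _ fun a => ?_)
  rw [← sub_mul, norm_mul]
  exact mul_le_mul_of_nonneg_left (hC a) (abs_nonneg _)

/-- The heat semigroup `P_s g (x) = 𝔼 g(x + √s N)`, `N` standard normal. By the Markov property it
is the mean of `g` at the end of a Brownian path that is at `x` a time `s` earlier. -/
noncomputable def heat (g : ℝ → ℝ) (s : ℝ≥0) (x : ℝ) : ℝ := ∫ w, g w ∂gaussianReal x s

variable {g : ℝ → ℝ} {C : ℝ}

lemma heat_eq_integral_add (g : ℝ → ℝ) (s : ℝ≥0) (x : ℝ) :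
    heat g s x = ∫ w, g (x + w) ∂gaussianReal 0 s := by
  have hmap : (gaussianReal 0 s).map (x + ·) = gaussianReal x s := by
    rw [gaussianReal_map_const_add, zero_add]
  rw [heat, ← hmap, (measurableEmbedding_addLeft x).integral_map]

lemma heat_eq_zero_of_antisymm {c : ℝ} (hg : ∀ w, g (2 * c - w) = -g w) (s : ℝ≥0) :
    heat g s c = 0 := by
  have hmap : (gaussianReal c s).map (2 * c - ·) = gaussianReal c s := by
    rw [gaussianReal_map_const_sub]; congr 1; ring
  have hneg : heat g s c = -heat g s c :=
    calc heat g s c = ∫ w, g w ∂(gaussianReal c s).map (2 * c - ·) := by rw [hmap, heat]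
      _ = ∫ w, g (2 * c - w) ∂gaussianReal c s :=
        (MeasurableEquiv.subLeft (2 * c)).measurableEmbedding.integral_map g
      _ = -heat g s c := by simp only [hg, integral_neg, heat]
  linarith

lemma abs_heat_le (hC : ∀ w, |g w| ≤ C) (s : ℝ≥0) (x : ℝ) : |heat g s x| ≤ C := by
  simpa [heat] using
    norm_integral_le_of_norm_le_const (μ := gaussianReal x s) (f := g) (ae_of_all _ hC)

lemma measurable_heat (hg : Measurable g) (s : ℝ≥0) : Measurable (heat g s) := by
  have hsm : StronglyMeasurable (fun p : ℝ × ℝ => g (p.1 + p.2)) :=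
    (hg.comp (by fun_prop)).stronglyMeasurable
  simpa only [← heat_eq_integral_add] using
    (hsm.integral_prod_right' (ν := gaussianReal 0 s)).measurable

lemma continuousAt_gaussianPDFReal {s : ℝ≥0} (hs : s ≠ 0) (x w : ℝ) :
    ContinuousAt (fun p : ℝ≥0 × ℝ => gaussianPDFReal p.2 p.1 w) (s, x) := by
  have hsqrt : √(2 * Real.pi * s) ≠ 0 := by positivity
  have hden : 2 * (s : ℝ) ≠ 0 := by positivity
  unfold gaussianPDFReal
  fun_prop (disch := assumption)

lemma continuousAt_heat (hg : Measurable g) (hC : ∀ w, |g w| ≤ C) {s : ℝ≥0} (hs : s ≠ 0) (x : ℝ) :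
    ContinuousAt (fun p : ℝ≥0 × ℝ => heat g p.1 p.2) (s, x) := by
  have hne : ∀ᶠ p : ℝ≥0 × ℝ in 𝓝 (s, x), p.1 ≠ 0 :=
    continuousAt_fst.eventually_ne hs
  have hpdf : ∀ {r : ℝ≥0} {y : ℝ}, r ≠ 0 → heat g r y = ∫ w, gaussianPDFReal y r w * g w :=
    fun hr => integral_gaussianReal_eq_integral_smul hr
  rw [ContinuousAt, hpdf hs]
  refine Tendsto.congr' (hne.mono fun p hp => (hpdf hp).symm) ?_
  refine tendsto_integral_mul_of_integral_eq hg.aestronglyMeasurable hC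
    (.of_forall fun _ => integrable_gaussianPDFReal _ _)
    (.of_forall fun _ => ae_of_all _ (gaussianPDFReal_nonneg _ _))
    (integrable_gaussianPDFReal _ _) (hne.mono fun p hp => ?_)
    (ae_of_all _ (continuousAt_gaussianPDFReal hs x))
  rw [integral_gaussianPDFReal_eq_one _ hp, integral_gaussianPDFReal_eq_one _ hs]

end Heat

section Stay

/-- The paths that remain in `U` up to and including time `r`. -/
def stay {E : Type*} (U : Set E) (r : ℝ≥0) : Set (ℝ≥0 → E) := {w | ∀ s ≤ r, w s ∈ U}

/-- The sequences that keep a positive distance from the complement of `U`. A continuous path lies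
in `stay U r` iff its samples at a dense set of times in `[0, r]` form such a sequence, which makes
`stay U r` a countably determined event. -/
def seqStay {E : Type*} [PseudoMetricSpace E] (U : Set E) : Set (ℕ → E) :=
  ⋃ n : ℕ, ⋂ i, {x | x i ∉ Metric.thickening (1 / (n + 1)) Uᶜ}

/-- A dense sequence of times in `[0, r]`. -/
noncomputable def sampleTime (r : ℝ≥0) (i : ℕ) : ℝ≥0 := min (TopologicalSpace.denseSeq ℝ≥0 i) r

variable {E : Type*}

lemma stay_antitone (U : Set E) : Antitone (stay U) := fun _ _ hrs _ hw s hs =>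
  hw s (hs.trans hrs)

lemma exists_exit_time [TopologicalSpace E] {U : Set E} (hU : IsOpen U) {w : ℝ≥0 → E}
    (hw : Continuous w) (h0 : w 0 ∈ U) {T : ℝ≥0} (hT : w ∉ stay U T) :
    ∃ τ ≤ T, w τ ∈ frontier U ∧ ∀ r, w ∈ stay U r ↔ r < τ := by
  simp only [stay, mem_ofPred_eq, not_forall] at hT
  obtain ⟨s₀, hs₀, hws₀⟩ := hT
  set τ := sInf (w ⁻¹' Uᶜ)
  have hexit : w τ ∉ U := (hU.isClosed_compl.preimage hw).csInf_mem ⟨s₀, hws₀⟩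
    (OrderBot.bddBelow _)
  have hbefore : ∀ s < τ, w s ∈ U := fun s hs => not_not.1 (notMem_of_lt_csInf' hs)
  have hτ0 : τ ≠ 0 := fun h => hexit (h ▸ h0)
  refine ⟨τ, (csInf_le' hws₀).trans hs₀, ?_, fun r => ⟨fun hr => ?_, fun hr s hs =>
    hbefore s (hs.trans_lt hr)⟩⟩
  · have hclosure : τ ∈ closure (Iio τ) := by
      rw [closure_Iio' ⟨0, pos_iff_ne_zero.2 hτ0⟩]
      exact self_mem_Iic
    exact hU.frontier_eq ▸ ⟨map_mem_closure hw hclosure hbefore, hexit⟩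
  · by_contra hτr
    exact hexit (hr τ (not_lt.1 hτr))

lemma measurableSet_seqStay [PseudoMetricSpace E] [MeasurableSpace E] [OpensMeasurableSpace E]
    (U : Set E) : MeasurableSet (seqStay U) :=
  .iUnion fun _ => .iInter fun i =>
    (Metric.isOpen_thickening.measurableSet.preimage (measurable_pi_apply i)).compl

lemma mem_stay_iff_mem_seqStay [PseudoMetricSpace E] {U : Set E} (hU : IsOpen U) {w : ℝ≥0 → E}
    (hw : Continuous w) (r : ℝ≥0) : w ∈ stay U r ↔ w ∘ sampleTime r ∈ seqStay U := by
  simp only [seqStay, mem_iUnion, mem_iInter, mem_ofPred_eq, Function.comp_apply]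
  refine ⟨fun h => ?_, fun ⟨n, hn⟩ s hs => ?_⟩
  · have hcompact : IsCompact (w '' Icc 0 r) := isCompact_Icc.image hw
    obtain ⟨δ, hδ, hsub⟩ := hcompact.exists_thickening_subset_open hU
      (image_subset_iff.2 fun s hs => h s hs.2)
    obtain ⟨n, hn⟩ := exists_nat_one_div_lt hδ
    refine ⟨n, fun i hi => ?_⟩
    obtain ⟨z, hzU, hz⟩ := Metric.mem_thickening_iff.1 hi
    refine hzU (hsub (Metric.mem_thickening_iff.2
      ⟨w (sampleTime r i), mem_image_of_mem w ⟨zero_le, min_le_right _ _⟩, ?_⟩))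
    rw [dist_comm]
    exact hz.trans hn
  · have hclosed : IsClosed {s | w (min s r) ∉ Metric.thickening (1 / (n + 1)) Uᶜ} :=
      Metric.isOpen_thickening.isClosed_compl.preimage (by fun_prop)
    have hs' : w (min s r) ∉ Metric.thickening (1 / (n + 1)) Uᶜ :=
      (TopologicalSpace.denseRange_denseSeq ℝ≥0).induction_on s hclosed hn
    rw [min_eq_left hs] at hs'
    exact not_not.1 (mt (Metric.self_subset_thickening (by positivity) Uᶜ ·) hs')

end Stay

section ExitSum

/-- The `k`-th point of the division of `[0, T]` into `n + 1` equal intervals. -/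
noncomputable def gridPt (T : ℝ≥0) (n k : ℕ) : ℝ≥0 := T * (k / (n + 1 : ℕ))

lemma gridPt_mono (T : ℝ≥0) (n : ℕ) : Monotone (gridPt T n) := fun a b hab => by
  unfold gridPt; gcongr

lemma gridPt_zero (T : ℝ≥0) (n : ℕ) : gridPt T n 0 = 0 := by simp [gridPt]

lemma gridPt_last (T : ℝ≥0) (n : ℕ) : gridPt T n (n + 1) = T := by simp [gridPt]

lemma gridPt_le (T : ℝ≥0) {n k : ℕ} (hk : k ≤ n + 1) : gridPt T n k ≤ T :=
  (gridPt_mono T n hk).trans_eq (gridPt_last T n)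

lemma dist_gridPt_succ_le {T τ : ℝ≥0} {n k : ℕ}
    (hτ : τ ∈ Icc (gridPt T n k) (gridPt T n (k + 1))) :
    dist (gridPt T n (k + 1)) τ ≤ T / (n + 1) := by
  have hmesh : (gridPt T n (k + 1) : ℝ) - gridPt T n k = T / (n + 1) := by
    simp only [gridPt]; push_cast; ring
  rw [← hmesh]
  exact Real.dist_le_of_mem_Icc ⟨NNReal.coe_le_coe.2 (gridPt_mono T n k.le_succ), le_rfl⟩
    ⟨NNReal.coe_le_coe.2 hτ.1, NNReal.coe_le_coe.2 hτ.2⟩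

lemma abs_sum_mul_sub_succ_le {a b : ℕ → ℝ} {ε : ℝ} {n : ℕ} (ha : Antitone a)
    (hb : ∀ k < n, a (k + 1) < a k → |b k| ≤ ε) :
    |∑ k ∈ Finset.range n, b k * (a k - a (k + 1))| ≤ ε * (a 0 - a n) := by
  rw [← Finset.sum_range_sub', Finset.mul_sum]
  refine (Finset.abs_sum_le_sum_abs _ _).trans (Finset.sum_le_sum fun k hk => ?_)
  rcases (ha k.le_succ).eq_or_lt with heq | hlt
  · simp [heq]
  · rw [abs_mul, abs_of_pos (sub_pos.2 hlt)]
    exact mul_le_mul_of_nonneg_right (hb k (Finset.mem_range.1 hk) hlt) (sub_pos.2 hlt).le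

/-- The value of `heat g (T - σ) (w σ)` at the time `σ` of exit of the path `w` from `U`, rounded up
to the next grid point, and `0` if the exit takes place after time `T` or not at all. -/
noncomputable def exitSum (g : ℝ → ℝ) (U : Set ℝ) (T : ℝ≥0) (n : ℕ) (w : ℝ≥0 → ℝ) : ℝ :=
  ∑ k ∈ Finset.range (n + 1), heat g (T - gridPt T n (k + 1)) (w (gridPt T n (k + 1))) *
    ((stay U (gridPt T n k)).indicator 1 w - (stay U (gridPt T n (k + 1))).indicator 1 w)

variable {g : ℝ → ℝ} {U : Set ℝ} {C : ℝ} {T : ℝ≥0} {w : ℝ≥0 → ℝ}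

lemma abs_exitSum_le {n : ℕ} {ε : ℝ} (hε : 0 ≤ ε)
    (H : ∀ k ≤ n, w ∈ stay U (gridPt T n k) → w ∉ stay U (gridPt T n (k + 1)) →
      |heat g (T - gridPt T n (k + 1)) (w (gridPt T n (k + 1)))| ≤ ε) :
    |exitSum g U T n w| ≤ ε := by
  set a : ℕ → ℝ := fun k => (stay U (gridPt T n k)).indicator 1 w
  have ha0 : ∀ k, 0 ≤ a k := fun k => indicator_nonneg (fun _ _ => zero_le_one) w
  have ha1 : ∀ k, a k ≤ 1 := fun k => indicator_le_self' (fun _ _ => zero_le_one) w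
  have hanti : Antitone a := fun j k hjk => indicator_le_indicator_of_subset
    (stay_antitone U (gridPt_mono T n hjk)) (fun _ => zero_le_one) w
  refine (abs_sum_mul_sub_succ_le hanti fun k hk hlt => H k (Nat.lt_succ_iff.1 hk) ?_ ?_).trans
    (mul_le_of_le_one_right hε (by linarith [ha1 0, ha0 (n + 1)]))
  · by_contra hw
    exact (ha0 (k + 1)).not_gt (hlt.trans_eq (indicator_of_notMem hw 1))
  · intro hw
    exact (ha1 k).not_gt ((indicator_of_mem hw 1).symm.trans_lt hlt)

lemma tendsto_heat_exit (hg : Measurable g) (hC : ∀ x, |g x| ≤ C) (hw : Continuous w) {τ : ℝ≥0}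
    (hτ : τ ≤ T) (hanti : ∀ x, g (2 * w τ - x) = -g x) :
    Tendsto (fun s => heat g (T - s) (w s)) (𝓝[Icc τ T] τ) (𝓝 0) := by
  rcases hτ.eq_or_lt with rfl | hlt
  · rw [Icc_self, nhdsWithin_singleton, tendsto_pure_left]
    intro s hs
    rw [heat_eq_zero_of_antisymm hanti]
    exact mem_of_mem_nhds hs
  · have hcont : ContinuousAt (fun s => heat g (T - s) (w s)) τ :=
      (continuousAt_heat hg hC (tsub_pos_of_lt hlt).ne' (w τ)).comp
        (f := fun s : ℝ≥0 => (T - s, w s)) (by fun_prop)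
    rw [← heat_eq_zero_of_antisymm hanti (T - τ)]
    exact hcont.continuousWithinAt

lemma tendsto_exitSum (hg : Measurable g) (hC : ∀ x, |g x| ≤ C) (hU : IsOpen U)
    (hanti : ∀ c ∈ frontier U, ∀ x, g (2 * c - x) = -g x) (hw : Continuous w) (h0 : w 0 ∈ U) :
    Tendsto (fun n => exitSum g U T n w) atTop (𝓝 0) := by
  rw [Metric.tendsto_atTop]
  intro ε hε
  simp only [dist_zero_right, Real.norm_eq_abs]
  by_cases hT : w ∈ stay U T
  · refine ⟨0, fun n _ => (abs_exitSum_le le_rfl fun k hk _ hexit => ?_).trans_lt hε⟩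
    exact absurd (stay_antitone U (gridPt_le T (by omega)) hT) hexit
  obtain ⟨τ, hτT, hτU, hτ⟩ := exists_exit_time hU hw h0 hT
  obtain ⟨δ, hδ, hheat⟩ := Metric.tendsto_nhdsWithin_nhds.1
    (tendsto_heat_exit hg hC hw hτT (hanti _ hτU)) (ε / 2) (half_pos hε)
  obtain ⟨N, hN⟩ := exists_nat_gt (T / δ : ℝ)
  have hmesh : ∀ n ≥ N, (T / (n + 1) : ℝ) < δ := fun n hn => by
    rw [div_lt_comm₀ (by positivity) hδ]
    exact hN.trans_le (by exact_mod_cast hn.trans n.le_succ)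
  refine ⟨N, fun n hn => (abs_exitSum_le (half_pos hε).le fun k hk hstay hexit => ?_).trans_lt
    (half_lt_self hε)⟩
  have hlow : gridPt T n k < τ := (hτ _).1 hstay
  have hupp : τ ≤ gridPt T n (k + 1) := not_lt.1 (mt (hτ _).2 hexit)
  have hnear := hheat ⟨hupp, gridPt_le T (by omega)⟩
    ((dist_gridPt_succ_le ⟨hlow.le, hupp⟩).trans_lt (hmesh n hn))
  rw [dist_zero_right] at hnear
  exact hnear.le

end ExitSum

section Markov

variable [MeasurableSpace Ω] {P : Measure Ω} {g : ℝ → ℝ} {C D : ℝ}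

lemma integral_comp_add_mul_of_indepFun {E : Type*} [MeasurableSpace E] {X Z : Ω → ℝ} {Y : Ω → E}
    {s : ℝ≥0} (hX : AEMeasurable X P) (hY : AEMeasurable Y P) (hZ : HasLaw Z (gaussianReal 0 s) P)
    (hind : IndepFun (fun ω => (X ω, Y ω)) Z P) (hg : Measurable g) (hC : ∀ x, |g x| ≤ C)
    {q : E → ℝ} (hq : Measurable q) (hD : ∀ y, |q y| ≤ D) :
    ∫ ω, g (X ω + Z ω) * q (Y ω) ∂P = ∫ ω, heat g s (X ω) * q (Y ω) ∂P := by
  have hP : IsProbabilityMeasure P := hZ.isProbabilityMeasure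
  have hXY : AEMeasurable (fun ω => (X ω, Y ω)) P := hX.prodMk hY
  have : IsProbabilityMeasure (P.map fun ω => (X ω, Y ω)) := Measure.isProbabilityMeasure_map hXY
  have hlaw := hind.map_prod_eq_prod_map_map hXY hZ.aemeasurable
  rw [hZ.map_eq] at hlaw
  have hmeas : Measurable fun p : (ℝ × E) × ℝ => g (p.1.1 + p.2) * q p.1.2 := by fun_prop
  have hheat : Measurable fun p : ℝ × E => heat g s p.1 * q p.2 :=
    ((measurable_heat hg s).comp measurable_fst).mul (hq.comp measurable_snd)
  calc ∫ ω, g (X ω + Z ω) * q (Y ω) ∂P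
      = ∫ p, g (p.1.1 + p.2) * q p.1.2 ∂(P.map fun ω => (X ω, Y ω)).prod (gaussianReal 0 s) := by
        rw [← hlaw, integral_map (hXY.prodMk hZ.aemeasurable) hmeas.aestronglyMeasurable]
    _ = ∫ p, ∫ z, g (p.1 + z) * q p.2 ∂gaussianReal 0 s ∂P.map fun ω => (X ω, Y ω) := by
        refine integral_prod _ (.of_bound hmeas.aestronglyMeasurable (C * D)
          (ae_of_all _ fun p => ?_))
        rw [Real.norm_eq_abs, abs_mul]
        exact mul_le_mul (hC _) (hD _) (abs_nonneg _) ((abs_nonneg _).trans (hC 0))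
    _ = ∫ p, heat g s p.1 * q p.2 ∂P.map fun ω => (X ω, Y ω) := by
        simp only [integral_mul_const, heat_eq_integral_add]
    _ = ∫ ω, heat g s (X ω) * q (Y ω) ∂P := integral_map hXY hheat.aestronglyMeasurable

variable {W : ℝ≥0 → Ω → ℝ} {r T : ℝ≥0}

theorem integral_mul_past_eq_integral_heat_mul_past (hW : IsPreBrownianReal W P) (hrT : r ≤ T)
    {ι : Type*} [Countable ι] {u : ι → ℝ≥0} (hu : ∀ i, u i ≤ r) (hg : Measurable g)
    (hC : ∀ x, |g x| ≤ C) {q : (ι → ℝ) → ℝ} (hq : Measurable q) (hD : ∀ y, |q y| ≤ D) :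
    ∫ ω, g (W T ω) * q (fun i => W (u i) ω) ∂P
      = ∫ ω, heat g (T - r) (W r ω) * q (fun i => W (u i) ω) ∂P := by
  have hincr : HasLaw (fun ω => W T ω - W r ω) (gaussianReal 0 (T - r)) P := by
    simpa only [add_tsub_cancel_of_le hrT] using (hW.shift r).hasLaw_eval (T - r)
  have hind : IndepFun (fun ω => (W r ω, fun i => W (u i) ω)) (fun ω => W T ω - W r ω) P := by
    have hpast : Measurable fun f : Iic r → ℝ => (f ⟨r, self_mem_Iic⟩, fun i => f ⟨u i, hu i⟩) := by
      fun_prop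
    simpa only [Function.comp_def, add_tsub_cancel_of_le hrT] using
      ((hW.indepFun_shift r).comp (measurable_pi_apply (T - r)) hpast).symm
  simpa only [add_sub_cancel] using integral_comp_add_mul_of_indepFun (hW.aemeasurable r)
    (aemeasurable_pi_lambda _ fun i => hW.aemeasurable (u i)) hincr hind hg hC hq hD

lemma ae_mem_stay_iff_mem_seqStay {E : Type*} [PseudoMetricSpace E] {V : ℝ≥0 → Ω → E}
    (hV : ∀ᵐ ω ∂P, Continuous (V · ω)) {U : Set E} (hU : IsOpen U) (r : ℝ≥0) :
    ∀ᵐ ω ∂P, (V · ω) ∈ stay U r ↔ (fun i => V (sampleTime r i) ω) ∈ seqStay U := by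
  filter_upwards [hV] with ω hω using mem_stay_iff_mem_seqStay hU hω r

lemma nullMeasurableSet_stay {E : Type*} [PseudoMetricSpace E] [MeasurableSpace E]
    [OpensMeasurableSpace E] {V : ℝ≥0 → Ω → E} (hV : ∀ t, AEMeasurable (V t) P)
    (hcont : ∀ᵐ ω ∂P, Continuous (V · ω)) {U : Set E} (hU : IsOpen U) (r : ℝ≥0) :
    NullMeasurableSet {ω | (V · ω) ∈ stay U r} P :=
  ((aemeasurable_pi_lambda _ fun i => hV (sampleTime r i)).nullMeasurableSet_preimage
    (measurableSet_seqStay U)).congr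
      ((ae_mem_stay_iff_mem_seqStay hcont hU r).mono fun _ h => propext h.symm)

variable {U : Set ℝ} {r' : ℝ≥0}

lemma integral_mul_stay_eq_integral_heat_mul_stay (hW : IsBrownianReal W P) (hU : IsOpen U)
    (hg : Measurable g) (hC : ∀ x, |g x| ≤ C) (hr : r' ≤ r) (hrT : r ≤ T) :
    ∫ ω, g (W T ω) * (stay U r').indicator 1 (W · ω) ∂P
      = ∫ ω, heat g (T - r) (W r ω) * (stay U r').indicator 1 (W · ω) ∂P := by
  have hsample : ∀ᵐ ω ∂P, (stay U r').indicator (1 : (ℝ≥0 → ℝ) → ℝ) (W · ω)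
      = (seqStay U).indicator 1 fun i => W (sampleTime r' i) ω := by
    filter_upwards [ae_mem_stay_iff_mem_seqStay hW.cont hU r'] with ω hω
    classical simp only [indicator_apply, hω, Pi.one_apply]
  calc ∫ ω, g (W T ω) * (stay U r').indicator 1 (W · ω) ∂P
      = ∫ ω, g (W T ω) * (seqStay U).indicator 1 (fun i => W (sampleTime r' i) ω) ∂P :=
        integral_congr_ae (hsample.mono fun ω hω => congrArg (g (W T ω) * ·) hω)
    _ = ∫ ω, heat g (T - r) (W r ω) *
          (seqStay U).indicator 1 (fun i => W (sampleTime r' i) ω) ∂P :=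
        integral_mul_past_eq_integral_heat_mul_past (D := 1) hW.toIsPreBrownianReal hrT
          (fun i => (min_le_right _ _).trans hr) hg hC
          (measurable_one.indicator (measurableSet_seqStay U))
          fun x => by by_cases hx : x ∈ seqStay U <;> simp [hx]
    _ = ∫ ω, heat g (T - r) (W r ω) * (stay U r').indicator 1 (W · ω) ∂P :=
        integral_congr_ae (hsample.mono fun ω hω => congrArg (heat g (T - r) (W r ω) * ·) hω.symm)

lemma integrable_comp_mul_stay (hW : IsBrownianReal W P) (hU : IsOpen U)
    (hg : Measurable g) (hC : ∀ x, |g x| ≤ C) (s r : ℝ≥0) :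
    Integrable (fun ω => g (W s ω) * (stay U r).indicator 1 (W · ω)) P := by
  have hP : IsProbabilityMeasure P := (hW.hasLaw_eval 0).isProbabilityMeasure
  have hstay : AEMeasurable (fun ω => (stay U r).indicator (1 : (ℝ≥0 → ℝ) → ℝ) (W · ω)) P :=
    (aemeasurable_indicator_const_iff (1 : ℝ)).2
      (nullMeasurableSet_stay hW.aemeasurable hW.cont hU r)
  refine .of_bound ((hg.comp_aemeasurable (hW.aemeasurable s)).mul hstay).aestronglyMeasurable C
    (ae_of_all _ fun ω => ?_)
  rw [norm_mul]
  refine (mul_le_of_le_one_right (norm_nonneg _) ?_).trans (hC (W s ω))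
  by_cases hω : (W · ω) ∈ stay U r <;> simp [hω]

end Markov

section Reflection

variable [MeasurableSpace Ω] {P : Measure Ω} {W : ℝ≥0 → Ω → ℝ} {U : Set ℝ}

lemma integral_exitSum (hW : IsBrownianReal W P) (hU : IsOpen U) {g : ℝ → ℝ} {C : ℝ}
    (hg : Measurable g) (hC : ∀ x, |g x| ≤ C) (T : ℝ≥0) (n : ℕ) :
    ∫ ω, exitSum g U T n (W · ω) ∂P = ∫ ω, g (W T ω) * (stay U 0).indicator 1 (W · ω) ∂P
      - ∫ ω, g (W T ω) * (stay U T).indicator 1 (W · ω) ∂P := by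
  have hint s := integrable_comp_mul_stay hW hU (measurable_heat hg s) (abs_heat_le hC s)
  simp only [exitSum, mul_sub]
  rw [integral_finsetSum _ fun k _ => by exact (hint _ _ _).sub (hint _ _ _)]
  have hmarkov : ∀ k ∈ Finset.range (n + 1),
      ∫ ω, heat g (T - gridPt T n (k + 1)) (W (gridPt T n (k + 1)) ω) *
          (stay U (gridPt T n k)).indicator 1 (W · ω)
        - heat g (T - gridPt T n (k + 1)) (W (gridPt T n (k + 1)) ω) *
          (stay U (gridPt T n (k + 1))).indicator 1 (W · ω) ∂P
      = ∫ ω, g (W T ω) * (stay U (gridPt T n k)).indicator 1 (W · ω) ∂P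
        - ∫ ω, g (W T ω) * (stay U (gridPt T n (k + 1))).indicator 1 (W · ω) ∂P := fun k hk => by
    have hkT : gridPt T n (k + 1) ≤ T := gridPt_le T (Finset.mem_range.1 hk)
    rw [integral_sub (hint _ _ _) (hint _ _ _),
      integral_mul_stay_eq_integral_heat_mul_stay hW hU hg hC (gridPt_mono T n k.le_succ) hkT,
      integral_mul_stay_eq_integral_heat_mul_stay hW hU hg hC le_rfl hkT]
  rw [Finset.sum_congr rfl hmarkov, Finset.sum_range_sub' fun k =>
    ∫ ω, g (W T ω) * (stay U (gridPt T n k)).indicator 1 (W · ω) ∂P, gridPt_zero, gridPt_last]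

theorem integral_eq_integral_mul_stay (hW : IsBrownianReal W P) (hU : IsOpen U) (h0 : 0 ∈ U)
    {g : ℝ → ℝ} {C : ℝ} (hg : Measurable g) (hC : ∀ x, |g x| ≤ C)
    (hanti : ∀ c ∈ frontier U, ∀ x, g (2 * c - x) = -g x) (T : ℝ≥0) :
    ∫ ω, g (W T ω) ∂P = ∫ ω, g (W T ω) * (stay U T).indicator 1 (W · ω) ∂P := by
  have hP : IsProbabilityMeasure P := (hW.hasLaw_eval 0).isProbabilityMeasure
  have hint s := integrable_comp_mul_stay hW hU (measurable_heat hg s) (abs_heat_le hC s)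
  have hlim : Tendsto (fun n => ∫ ω, exitSum g U T n (W · ω) ∂P) atTop (𝓝 (∫ _, 0 ∂P)) := by
    refine tendsto_integral_of_dominated_convergence (fun _ => C) (fun n => ?_)
      (integrable_const C) (fun n => ae_of_all _ fun ω => ?_) ?_
    · simp only [exitSum, mul_sub]
      exact (integrable_finsetSum _ fun k _ =>
        (hint _ _ _).sub (hint _ _ _)).aestronglyMeasurable
    · exact abs_exitSum_le ((abs_nonneg _).trans (hC 0)) fun k _ _ _ => abs_heat_le hC _ _
    · filter_upwards [hW.cont, hW.eval_zero_ae_eq_zero] with ω hω hω0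
      exact tendsto_exitSum hg hC hU hanti hω (by simpa only [hω0])
  simp only [integral_exitSum hW hU hg hC, integral_zero] at hlim
  have hzero := tendsto_nhds_unique tendsto_const_nhds hlim
  have hstart : ∫ ω, g (W T ω) * (stay U 0).indicator 1 (W · ω) ∂P = ∫ ω, g (W T ω) ∂P := by
    refine integral_congr_ae ?_
    filter_upwards [hW.eval_zero_ae_eq_zero] with ω hω
    have hmem : (W · ω) ∈ stay U 0 := fun s hs => by
      simpa only [nonpos_iff_eq_zero.1 hs, hω] using h0
    rw [indicator_of_mem hmem, Pi.one_apply, mul_one]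
  linarith

theorem measureReal_mem_and_stay (hW : IsBrownianReal W P) (hU : IsOpen U) (h0 : 0 ∈ U)
    {A B : Set ℝ} (hA : MeasurableSet A) (hB : MeasurableSet B)
    (hAB : ∀ c ∈ frontier U, ∀ x, 2 * c - x ∈ A ↔ x ∈ B) (hUB : Disjoint U B) (T : ℝ≥0) :
    P.real {ω | W T ω ∈ A ∧ (W · ω) ∈ stay U T}
      = (gaussianReal 0 T).real A - (gaussianReal 0 T).real B := by
  set g : ℝ → ℝ := fun x => A.indicator 1 x - B.indicator 1 x with hg
  have hgm : Measurable g := (measurable_one.indicator hA).sub (measurable_one.indicator hB)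
  have hg1 : ∀ x, |g x| ≤ 1 := fun x => by
    by_cases hxA : x ∈ A <;> by_cases hxB : x ∈ B <;> simp [hg, hxA, hxB]
  have hanti : ∀ c ∈ frontier U, ∀ x, g (2 * c - x) = -g x := fun c hc x => by
    have hBA : 2 * c - x ∈ B ↔ x ∈ A := by rw [← hAB c hc, sub_sub_cancel]
    classical simp only [hg, indicator_apply, hAB c hc, hBA, neg_sub, Pi.one_apply]
  have hlaw : ∫ ω, g (W T ω) ∂P = (gaussianReal 0 T).real A - (gaussianReal 0 T).real B := by
    have hint {S : Set ℝ} (hS : MeasurableSet S) :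
        Integrable (S.indicator (1 : ℝ → ℝ)) (gaussianReal 0 T) :=
      (integrable_const (1 : ℝ)).indicator hS
    rw [← integral_indicator_one hA, ← integral_indicator_one hB,
      ← integral_sub (hint hA) (hint hB)]
    exact (hW.hasLaw_eval T).integral_comp hgm.aestronglyMeasurable
  have hnull : NullMeasurableSet {ω | W T ω ∈ A ∧ (W · ω) ∈ stay U T} P :=
    ((hW.aemeasurable T).nullMeasurableSet_preimage hA).inter
      (nullMeasurableSet_stay hW.aemeasurable hW.cont hU T)
  have hstay : ∀ ω, g (W T ω) * (stay U T).indicator 1 (W · ω)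
      = {ω | W T ω ∈ A ∧ (W · ω) ∈ stay U T}.indicator 1 ω := fun ω => by
    by_cases hω : (W · ω) ∈ stay U T
    · have hWB : W T ω ∉ B := hUB.notMem_of_mem_left (hω T le_rfl)
      by_cases hWA : W T ω ∈ A <;> simp [hg, hω, hWA, hWB]
    · simp [hω]
  rw [← hlaw, integral_eq_integral_mul_stay hW hU h0 hgm hg1 hanti]
  simp only [hstay, integral_indicator₀ hnull, Pi.one_apply, setIntegral_const, smul_eq_mul,
    mul_one]

end Reflection

section Phi

lemma Phi_eq_measureReal_Iic (x : ℝ) : Phi x = (gaussianReal 0 1).real (Iic x) := cdf_eq_real _ x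

lemma Phi_nonneg (x : ℝ) : 0 ≤ Phi x := cdf_nonneg _ x

lemma gaussianReal_real_neg_preimage (v : ℝ≥0) {A : Set ℝ} (hA : MeasurableSet A) :
    (gaussianReal 0 v).real ((fun x => -x) ⁻¹' A) = (gaussianReal 0 v).real A := by
  rw [← map_measureReal_apply measurable_neg hA, gaussianReal_map_neg, neg_zero]

lemma gaussianReal_real_Ici (x : ℝ) : (gaussianReal 0 1).real (Ici x) = Phi (-x) := by
  rw [Phi_eq_measureReal_Iic, ← gaussianReal_real_neg_preimage 1 measurableSet_Iic]
  simp

lemma gaussianReal_real_Icc {a b : ℝ} (hab : a ≤ b) :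
    (gaussianReal 0 1).real (Icc a b) = Phi b - Phi a := by
  have := nullSingletonClass_gaussianReal (μ := 0) one_ne_zero
  rw [Phi_eq_measureReal_Iic, Phi_eq_measureReal_Iic,
    ← measureReal_sdiff (Iic_subset_Iic.2 hab) measurableSet_Iic, Iic_sdiff_Iic]
  exact measureReal_congr Ioc_ae_eq_Icc.symm

lemma Phi_neg (x : ℝ) : Phi (-x) = 1 - Phi x := by
  have := nullSingletonClass_gaussianReal (μ := 0) one_ne_zero
  rw [← gaussianReal_real_Ici, Phi_eq_measureReal_Iic,
    ← probReal_compl_eq_one_sub measurableSet_Iic, compl_Iic]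
  exact measureReal_congr Ioi_ae_eq_Ici.symm

lemma Phi_zero : Phi 0 = 1 / 2 := by
  have h := Phi_neg 0
  rw [neg_zero] at h
  linarith

lemma Phi_le_exp (x : ℝ) : Phi x ≤ Real.exp (x + 1 / 2) := by
  have hchernoff := measure_le_le_exp_mul_mgf (μ := gaussianReal 0 1) (X := id) (t := -1) x
    (by norm_num) (integrable_exp_mul_gaussianReal (-1))
  rw [mgf_id_gaussianReal, ← Real.exp_add] at hchernoff
  rw [Phi_eq_measureReal_Iic]
  exact hchernoff.trans_eq (by norm_num)

lemma summable_Phi_sub_mul (q : ℝ) {s : ℝ} (hs : 0 < s) :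
    Summable (fun k : ℕ => Phi (q - k * s)) := by
  have hgeo : Summable (fun k : ℕ => Real.exp (q + 1 / 2) * Real.exp (-s) ^ k) :=
    (summable_geometric_of_lt_one (Real.exp_pos _).le (by simpa using hs)).mul_left _
  refine hgeo.of_nonneg_of_le (fun k => Phi_nonneg _) fun k => (Phi_le_exp _).trans_eq ?_
  rw [← Real.exp_nat_mul, ← Real.exp_add]
  ring_nf

lemma summable_psiTerm (q r : ℝ) {s : ℝ} (hs : 0 < s) : Summable (psiTerm q r s) :=
  (summable_Phi_sub_mul q hs).sub (summable_Phi_sub_mul (q - r) hs)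

lemma Psi_eq_add (q r : ℝ) {s : ℝ} (hs : 0 < s) :
    Psi q r s = Phi q - Phi (q - r) + Psi (q - s) r s := by
  rw [Psi, (summable_psiTerm q r hs).tsum_eq_zero_add, Psi]
  congr 1
  · simp [psiTerm]
  · refine tsum_congr fun k => ?_
    simp only [psiTerm]
    push_cast
    ring_nf

lemma hasSum_int_Phi_sub (q r : ℝ) {s : ℝ} (hs : 0 < s) :
    HasSum (fun k : ℤ => Phi (q - k * s) - Phi (q - r - k * s))
      (Psi q r s + Psi (r - q - s) r s) := by
  have hneg : psiTerm (r - q - s) r s = fun k : ℕ =>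
      Phi (q - (-(k + 1 : ℤ) : ℤ) * s) - Phi (q - r - (-(k + 1 : ℤ) : ℤ) * s) := funext fun k => by
    have hq : r - q - s - k * s = -(q - r - (-(k + 1 : ℤ) : ℤ) * s) := by push_cast; ring
    have hr : r - q - s - r - k * s = -(q - (-(k + 1 : ℤ) : ℤ) * s) := by push_cast; ring
    rw [psiTerm, hq, hr, Phi_neg, Phi_neg]
    ring
  refine HasSum.of_nat_of_neg_add_one (summable_psiTerm q r hs).hasSum ?_
  exact hneg ▸ (summable_psiTerm (r - q - s) r hs).hasSum

end Phi

section Periodic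

/-- The intervals `[a, b] + k s`, `k ∈ ℤ`: the image of `[a, b]` under translation by multiples
of `s`. With `s = 2 (y - z)` these are the translations generated by the reflections about `y`
and `z`. -/
def periodicIcc (a b s : ℝ) : Set ℝ := ⋃ k : ℤ, Icc (a - k * s) (b - k * s)

lemma mem_periodicIcc {a b s x : ℝ} :
    x ∈ periodicIcc a b s ↔ ∃ k : ℤ, a - k * s ≤ x ∧ x ≤ b - k * s := mem_iUnion

lemma measurableSet_periodicIcc (a b s : ℝ) : MeasurableSet (periodicIcc a b s) :=
  .iUnion fun _ => measurableSet_Icc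

lemma const_sub_mem_periodicIcc {a b c s x : ℝ} :
    c - x ∈ periodicIcc a b s ↔ x ∈ periodicIcc (c - b) (c - a) s := by
  simp only [mem_periodicIcc]
  refine (Equiv.neg ℤ).exists_congr fun k => ?_
  simp only [Equiv.neg_apply]
  push_cast
  constructor <;> rintro ⟨h₁, h₂⟩ <;> constructor <;> linarith

lemma periodicIcc_sub_period (a b s : ℝ) : periodicIcc (a - s) (b - s) s = periodicIcc a b s := by
  ext x
  simp only [mem_periodicIcc]
  refine (Equiv.addRight 1).exists_congr fun k => ?_
  simp only [Equiv.coe_addRight]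
  push_cast
  constructor <;> rintro ⟨h₁, h₂⟩ <;> constructor <;> linarith

lemma mem_periodicIcc_iff_le {a b s x : ℝ} (hs : 0 < s) (hax : a ≤ x) (hxa : x < a + s) :
    x ∈ periodicIcc a b s ↔ x ≤ b := by
  refine mem_periodicIcc.trans ⟨fun ⟨k, hak, hxb⟩ => ?_, fun hxb => ⟨0, by simpa using ⟨hax, hxb⟩⟩⟩
  have hlt : ((-1 : ℤ) : ℝ) < k := by
    push_cast
    exact lt_of_mul_lt_mul_right (by linarith) hs.le
  have hk : (0 : ℝ) ≤ k := mod_cast Int.add_one_le_of_lt (Int.cast_lt.1 hlt)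
  linarith [mul_nonneg hk hs.le]

lemma gaussianReal_real_periodicIcc_neg (v : ℝ≥0) (a b s : ℝ) :
    (gaussianReal 0 v).real (periodicIcc (-b) (-a) s)
      = (gaussianReal 0 v).real (periodicIcc a b s) := by
  rw [← gaussianReal_real_neg_preimage v (measurableSet_periodicIcc a b s)]
  congr 1
  ext x
  simpa only [zero_sub, mem_preimage] using (const_sub_mem_periodicIcc (c := 0)).symm

lemma hasSum_measureReal_periodicIcc (μ : Measure ℝ) [IsFiniteMeasure μ] {a b s : ℝ}
    (hs : 0 < s) (hb : b < a + s) :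
    HasSum (fun k : ℤ => μ.real (Icc (a - k * s) (b - k * s))) (μ.real (periodicIcc a b s)) := by
  have hdisj : Pairwise (Function.onFun Disjoint fun k : ℤ => Icc (a - k * s) (b - k * s)) := by
    refine (pairwise_disjoint_on _).2 fun m n hmn => disjoint_left.2 fun x hm hn => ?_
    have hmul : ((m : ℝ) + 1) * s ≤ n * s := by
      have : (m : ℝ) + 1 ≤ n := by exact_mod_cast hmn
      gcongr
    linarith [hm.1, hn.2]
  have hsum := hasSum_integral_iUnion (μ := μ) (f := fun _ => (1 : ℝ))
    (fun _ => measurableSet_Icc) hdisj (integrable_const _).integrableOn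
  simp only [setIntegral_const, smul_eq_mul, mul_one] at hsum
  exact hsum

lemma hasSum_gaussianReal_periodicIcc {a b s : ℝ} (hs : 0 < s) (hab : a ≤ b) (hb : b < a + s) :
    HasSum (fun k : ℤ => Phi (b - k * s) - Phi (a - k * s))
      ((gaussianReal 0 1).real (periodicIcc a b s)) := by
  simpa only [gaussianReal_real_Icc (sub_le_sub_right hab _)] using
    hasSum_measureReal_periodicIcc (gaussianReal 0 1) hs hb

theorem gaussianReal_periodicIcc_sub_eq_Psi {a b r s : ℝ} (hs : 0 < s) (hab : a ≤ b)
    (hb : b < a + s) :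
    (gaussianReal 0 1).real (periodicIcc a b s)
        - (gaussianReal 0 1).real (periodicIcc (r - b) (r - a) s)
      = Psi b r s + Psi (r - b - s) r s - (Psi a r s + Psi (r - a - s) r s) := by
  rw [← gaussianReal_real_periodicIcc_neg 1 (r - b), neg_sub, neg_sub]
  have hAB := (hasSum_gaussianReal_periodicIcc hs hab hb).sub
    (hasSum_gaussianReal_periodicIcc hs (sub_le_sub_right hab r) (by linarith))
  have hPsi := (hasSum_int_Phi_sub b r hs).sub (hasSum_int_Phi_sub a r hs)
  refine hAB.unique ?_
  convert hPsi using 2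
  ring

end Periodic

section Extrema

variable {W : ℝ≥0 → Ω → ℝ} {ω : Ω} {t : ℝ≥0} {y z : ℝ}

lemma runMax_lt_iff (hω : Continuous (W · ω)) : runMax W t ω < y ↔ (W · ω) ∈ stay (Iio y) t := by
  rw [runMax, isCompact_Icc.sSup_lt_iff_of_continuous (nonempty_Icc.2 zero_le) hω.continuousOn]
  simp [stay]

lemma lt_runMin_iff (hω : Continuous (W · ω)) : z < runMin W t ω ↔ (W · ω) ∈ stay (Ioi z) t := by
  rw [runMin, isCompact_Icc.lt_sInf_iff_of_continuous (nonempty_Icc.2 zero_le) hω.continuousOn]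
  simp [stay]

lemma runMax_lt_and_lt_runMin_iff (hω : Continuous (W · ω)) :
    runMax W t ω < y ∧ z < runMin W t ω ↔ (W · ω) ∈ stay (Ioo z y) t := by
  rw [runMax_lt_iff hω, lt_runMin_iff hω, and_comm]
  exact forall₂_and.symm

lemma le_runMax (hω : Continuous (W · ω)) {s : ℝ≥0} (hs : s ≤ t) : W s ω ≤ runMax W t ω :=
  le_csSup (isCompact_Icc.image hω).bddAbove (mem_image_of_mem _ ⟨zero_le, hs⟩)

lemma runMin_le (hω : Continuous (W · ω)) {s : ℝ≥0} (hs : s ≤ t) : runMin W t ω ≤ W s ω :=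
  csInf_le (isCompact_Icc.image hω).bddBelow (mem_image_of_mem _ ⟨zero_le, hs⟩)

variable [MeasurableSpace Ω] {P : Measure Ω}

lemma aemeasurable_runMax (hW : ∀ s, AEMeasurable (W s) P) (hcont : ∀ᵐ ω ∂P, Continuous (W · ω))
    (t : ℝ≥0) : AEMeasurable (runMax W t) P := by
  have hIio (y : ℝ) : NullMeasurableSet (runMax W t ⁻¹' Iio y) P := by
    refine (nullMeasurableSet_stay hW hcont (isOpen_Iio (a := y)) t).congr ?_
    filter_upwards [hcont] with ω hω using propext (runMax_lt_iff hω).symm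
  exact NullMeasurable.aemeasurable (measurable_of_Iio (δ := NullMeasurableSpace Ω P) hIio)

lemma aemeasurable_runMin (hW : ∀ s, AEMeasurable (W s) P) (hcont : ∀ᵐ ω ∂P, Continuous (W · ω))
    (t : ℝ≥0) : AEMeasurable (runMin W t) P := by
  have hIoi (z : ℝ) : NullMeasurableSet (runMin W t ⁻¹' Ioi z) P := by
    refine (nullMeasurableSet_stay hW hcont (isOpen_Ioi (a := z)) t).congr ?_
    filter_upwards [hcont] with ω hω using propext (lt_runMin_iff hω).symm
  exact NullMeasurable.aemeasurable (measurable_of_Ioi (δ := NullMeasurableSpace Ω P) hIoi)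

lemma aemeasurable_prod_runMax_runMin (hW : IsBrownianReal W P) (t : ℝ≥0) :
    AEMeasurable (fun ω => (W t ω, runMax W t ω, runMin W t ω)) P :=
  (hW.aemeasurable t).prodMk ((aemeasurable_runMax hW.aemeasurable hW.cont t).prodMk
    (aemeasurable_runMin hW.aemeasurable hW.cont t))

lemma jointCDF_eq_measureReal (hW : IsBrownianReal W P) (t : ℝ≥0) (x y z : ℝ) :
    jointCDF W P t x y z
      = P.real {ω | W t ω ≤ x ∧ runMax W t ω ≤ y ∧ runMin W t ω ≤ z} :=
  map_measureReal_apply_of_aemeasurable (aemeasurable_prod_runMax_runMin hW t)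
    (measurableSet_Iic.prod (measurableSet_Iic.prod measurableSet_Iic))

lemma ae_runMax_nonneg (hW : IsBrownianReal W P) (t : ℝ≥0) : ∀ᵐ ω ∂P, 0 ≤ runMax W t ω := by
  filter_upwards [hW.cont, hW.eval_zero_ae_eq_zero] with ω hω h0
  exact h0 ▸ le_runMax hω zero_le

lemma ae_runMin_nonpos (hW : IsBrownianReal W P) (t : ℝ≥0) : ∀ᵐ ω ∂P, runMin W t ω ≤ 0 := by
  filter_upwards [hW.cont, hW.eval_zero_ae_eq_zero] with ω hω h0
  exact h0 ▸ runMin_le hω zero_le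

end Extrema

section OneSided

variable [MeasurableSpace Ω] {P : Measure Ω} {W : ℝ≥0 → Ω → ℝ} {x y : ℝ}

theorem measureReal_le_and_runMax_lt (hW : IsBrownianReal W P) (hy : 0 < y) (hxy : x ≤ y) :
    P.real {ω | W 1 ω ≤ x ∧ runMax W 1 ω < y} = Phi x - Phi (x - 2 * y) := by
  have hrefl : ∀ c ∈ frontier (Iio y), ∀ w, 2 * c - w ∈ Iic x ↔ w ∈ Ici (2 * y - x) := by
    rw [frontier_Iio]
    rintro c rfl w
    rw [mem_Iic, mem_Ici, sub_le_comm]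
  have hdisj : Disjoint (Iio y) (Ici (2 * y - x)) := Iio_disjoint_Ici (by linarith)
  calc P.real {ω | W 1 ω ≤ x ∧ runMax W 1 ω < y}
      = P.real {ω | W 1 ω ∈ Iic x ∧ (W · ω) ∈ stay (Iio y) 1} := by
        refine measureReal_congr ?_
        filter_upwards [hW.cont] with ω hω using
          propext (and_congr_right fun _ => runMax_lt_iff hω)
    _ = Phi x - Phi (x - 2 * y) := by
        rw [measureReal_mem_and_stay hW isOpen_Iio hy measurableSet_Iic measurableSet_Ici hrefl
          hdisj, ← Phi_eq_measureReal_Iic, gaussianReal_real_Ici, neg_sub]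

lemma measureReal_runMax_lt (hW : IsBrownianReal W P) (hy : 0 ≤ y) :
    P.real {ω | runMax W 1 ω < y} = 2 * Phi y - 1 := by
  rcases hy.eq_or_lt with rfl | hy
  · have hnull : P {ω | runMax W 1 ω < 0} = 0 := by
      simpa only [not_le] using ae_iff.1 (ae_runMax_nonneg hW 1)
    rw [measureReal_def, hnull, Phi_zero]
    norm_num
  · calc P.real {ω | runMax W 1 ω < y}
        = P.real {ω | W 1 ω ≤ y ∧ runMax W 1 ω < y} := by
          refine measureReal_congr ?_
          filter_upwards [hW.cont] with ω hω
          exact propext (iff_and_self.2 fun hlt => (le_runMax hω le_rfl).trans hlt.le)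
      _ = Phi y - Phi (-y) := by
          rw [measureReal_le_and_runMax_lt hW hy le_rfl]
          ring_nf
      _ = 2 * Phi y - 1 := by
          rw [Phi_neg]
          ring

lemma ae_runMax_ne (hW : IsBrownianReal W P) (hy : 0 ≤ y) : ∀ᵐ ω ∂P, runMax W 1 ω ≠ y := by
  have := (hW.hasLaw_eval 0).isProbabilityMeasure
  have hmeas := aemeasurable_runMax hW.aemeasurable hW.cont 1
  have hle (v : ℝ) (hv : y < v) : P.real (runMax W 1 ⁻¹' {y}) ≤ 2 * Phi v - 2 * Phi y := by
    have hdisj : Disjoint (runMax W 1 ⁻¹' {y}) (runMax W 1 ⁻¹' Iio y) :=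
      .preimage _ (by simp)
    have hsub : runMax W 1 ⁻¹' {y} ∪ runMax W 1 ⁻¹' Iio y ⊆ runMax W 1 ⁻¹' Iio v :=
      union_subset (preimage_mono (singleton_subset_iff.2 hv))
        (preimage_mono (Iio_subset_Iio hv.le))
    have hadd := measureReal_mono (μ := P) hsub
    rw [measureReal_union₀ (hmeas.nullMeasurableSet_preimage measurableSet_Iio) hdisj.aedisjoint]
      at hadd
    have hy' : P.real (runMax W 1 ⁻¹' Iio y) = 2 * Phi y - 1 := measureReal_runMax_lt hW hy
    have hv' : P.real (runMax W 1 ⁻¹' Iio v) = 2 * Phi v - 1 :=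
      measureReal_runMax_lt hW (hy.trans hv.le)
    linarith
  have hlim : Tendsto (fun v => 2 * Phi v - 2 * Phi y) (𝓝[>] y) (𝓝 0) := by
    have hcont : Tendsto Phi (𝓝[>] y) (𝓝 (Phi y)) :=
      ((cdf (gaussianReal 0 1)).right_continuous y).mono Ioi_subset_Ici_self
    simpa using (hcont.const_mul 2).sub_const (2 * Phi y)
  have hnull : P.real (runMax W 1 ⁻¹' {y}) = 0 :=
    (ge_of_tendsto hlim (eventually_nhdsWithin_of_forall hle)).antisymm measureReal_nonneg
  exact measure_eq_zero_iff_ae_notMem.1 ((measureReal_eq_zero_iff).1 hnull)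

end OneSided

section TwoSided

variable [MeasurableSpace Ω] {P : Measure Ω} {W : ℝ≥0 → Ω → ℝ} {x y z : ℝ}

theorem measureReal_le_and_runMax_lt_and_lt_runMin (hW : IsBrownianReal W P) (hz : z < 0)
    (hy : 0 < y) (hzx : z ≤ x) (hxy : x ≤ y) :
    P.real {ω | W 1 ω ≤ x ∧ runMax W 1 ω < y ∧ z < runMin W 1 ω}
      = Psi x (2 * y) (2 * (y - z)) + Psi (2 * z - x) (2 * y) (2 * (y - z))
        - 2 * Psi z (2 * y) (2 * (y - z)) := by
  set s := 2 * (y - z) with hs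
  have hzy : z < y := hz.trans hy
  have hB : periodicIcc (2 * y - x) (2 * y - z) s = periodicIcc (2 * z - x) z s := by
    rw [← periodicIcc_sub_period]
    congr 1 <;> ring
  have hrefl : ∀ c ∈ frontier (Ioo z y), ∀ w,
      2 * c - w ∈ periodicIcc z x s ↔ w ∈ periodicIcc (2 * y - x) (2 * y - z) s := by
    rw [frontier_Ioo hzy]
    rintro c (rfl | rfl) w
    · rw [hB, const_sub_mem_periodicIcc, two_mul, add_sub_cancel_right]
    · exact const_sub_mem_periodicIcc
  have hdisj : Disjoint (Ioo z y) (periodicIcc (2 * y - x) (2 * y - z) s) := by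
    refine disjoint_left.2 fun w hw hwB => ?_
    rw [hB, mem_periodicIcc_iff_le (by linarith) (by linarith [hw.1]) (by linarith [hw.2])] at hwB
    exact hw.1.not_ge hwB
  calc P.real {ω | W 1 ω ≤ x ∧ runMax W 1 ω < y ∧ z < runMin W 1 ω}
      = P.real {ω | W 1 ω ∈ periodicIcc z x s ∧ (W · ω) ∈ stay (Ioo z y) 1} := by
        refine measureReal_congr ?_
        filter_upwards [hW.cont] with ω hω
        refine propext ((and_congr_right' (runMax_lt_and_lt_runMin_iff hω)).trans
          (and_congr_left fun hstay => ?_))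
        obtain ⟨hzW, hWy⟩ := hstay 1 le_rfl
        exact (mem_periodicIcc_iff_le (by linarith) hzW.le (by linarith)).symm
    _ = Psi x (2 * y) s + Psi (2 * y - x - s) (2 * y) s
          - (Psi z (2 * y) s + Psi (2 * y - z - s) (2 * y) s) := by
        rw [measureReal_mem_and_stay hW isOpen_Ioo ⟨hz, hy⟩ (measurableSet_periodicIcc _ _ _)
          (measurableSet_periodicIcc _ _ _) hrefl hdisj]
        exact gaussianReal_periodicIcc_sub_eq_Psi (by linarith) hzx (by linarith)
    _ = Psi x (2 * y) s + Psi (2 * z - x) (2 * y) s - 2 * Psi z (2 * y) s := by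
        rw [show 2 * y - x - s = 2 * z - x by linarith, show 2 * y - z - s = z by linarith]
        ring

end TwoSided

section JointCDF

variable [MeasurableSpace Ω] {P : Measure Ω} {W : ℝ≥0 → Ω → ℝ} {x y z : ℝ}

lemma jointCDF_one_of_nonpos (hW : IsBrownianReal W P) (hy : y ≤ 0) :
    jointCDF W P 1 x y z = 0 := by
  rw [jointCDF_eq_measureReal hW, measureReal_def, measure_eq_zero_iff_ae_notMem.2,
    ENNReal.toReal_zero]
  filter_upwards [ae_runMax_nonneg hW 1, ae_runMax_ne hW le_rfl] with ω hnonneg hne hmem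
  exact hne ((hmem.2.1.trans hy).antisymm hnonneg)

lemma jointCDF_one_of_pos (hW : IsBrownianReal W P) (hy : 0 < y) :
    jointCDF W P 1 x y z = P.real {ω | W 1 ω ≤ x ∧ runMax W 1 ω < y}
      - P.real {ω | W 1 ω ≤ x ∧ runMax W 1 ω < y ∧ z < runMin W 1 ω} := by
  have := (hW.hasLaw_eval 0).isProbabilityMeasure
  have hsplit := measureReal_inter_add_sdiff₀ (μ := P)
    (s := {ω | W 1 ω ≤ x ∧ runMax W 1 ω < y})
    ((aemeasurable_runMin hW.aemeasurable hW.cont 1).nullMeasurableSet_preimage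
      (measurableSet_Ioi (a := z)))
  have hinter : {ω | W 1 ω ≤ x ∧ runMax W 1 ω < y} ∩ runMin W 1 ⁻¹' Ioi z
      = {ω | W 1 ω ≤ x ∧ runMax W 1 ω < y ∧ z < runMin W 1 ω} :=
    ext fun _ => and_assoc
  have hsdiff : {ω | W 1 ω ≤ x ∧ runMax W 1 ω < y} \ runMin W 1 ⁻¹' Ioi z
      = {ω | W 1 ω ≤ x ∧ runMax W 1 ω < y ∧ runMin W 1 ω ≤ z} := by
    ext ω
    simp [and_assoc]
  rw [hinter, hsdiff] at hsplit
  rw [jointCDF_eq_measureReal hW, ← hsplit, add_sub_cancel_left]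
  refine measureReal_congr ?_
  filter_upwards [ae_runMax_ne hW hy.le] with ω hne
  exact propext (and_congr_right' (and_congr_left' hne.le_iff_lt))

lemma jointCDF_one_of_nonneg_or_lt (hW : IsBrownianReal W P) (hy : 0 < y) (hxy : x ≤ y)
    (h : 0 ≤ z ∨ x < z) : jointCDF W P 1 x y z = Phi x - Phi (x - 2 * y) := by
  have hnull : P.real {ω | W 1 ω ≤ x ∧ runMax W 1 ω < y ∧ z < runMin W 1 ω} = 0 := by
    rw [measureReal_def, measure_eq_zero_iff_ae_notMem.2, ENNReal.toReal_zero]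
    filter_upwards [hW.cont, ae_runMin_nonpos hW 1] with ω hω hnonpos ⟨hWx, _, hzm⟩
    have hmW : runMin W 1 ω ≤ W 1 ω := runMin_le hω le_rfl
    rcases h with hz | hxz <;> linarith
  rw [jointCDF_one_of_pos hW hy, measureReal_le_and_runMax_lt hW hy hxy, hnull, sub_zero]

lemma jointCDF_one_min (hW : IsBrownianReal W P) :
    jointCDF W P 1 (min x y) y z = jointCDF W P 1 x y z := by
  rw [jointCDF_eq_measureReal hW, jointCDF_eq_measureReal hW]
  refine measureReal_congr ?_
  filter_upwards [hW.cont] with ω hω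
  refine propext (and_congr_left fun ⟨hM, _⟩ => le_min_iff.trans (and_iff_left ?_))
  exact (le_runMax hω le_rfl).trans hM

lemma F_min : F (min x y) y z = F x y z := by
  rcases le_or_gt x y with hxy | hxy
  · rw [min_eq_left hxy]
  · rw [min_eq_right hxy.le]
    simp only [F, lt_irrefl, le_refl, if_true, if_false, hxy.not_gt, hxy.not_ge]
    split_ifs <;> first | rfl | (exfalso; linarith) | ring_nf

lemma F_of_le_of_nonneg_or_lt (hy : 0 < y) (hxy : x ≤ y) (h : 0 ≤ z ∨ x < z) :
    F x y z = Phi x - Phi (x - 2 * y) := by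
  rw [F, if_neg hy.not_ge]
  split_ifs with hz hlt hlt
  · rfl
  · rw [hxy.antisymm (not_lt.1 hlt), show y - 2 * y = -y by ring, Phi_neg]
    ring
  · rfl
  all_goals exact absurd h (not_or_intro hz hlt)

lemma F_of_neg_of_le (hz : z < 0) (hy : 0 < y) (hzx : z ≤ x) (hxy : x ≤ y) :
    F x y z = Phi x - Phi (x - 2 * y)
      - (Psi x (2 * y) (2 * (y - z)) + Psi (2 * z - x) (2 * y) (2 * (y - z))
        - 2 * Psi z (2 * y) (2 * (y - z))) := by
  rw [Psi_eq_add x (2 * y) (by linarith), F, if_neg hy.not_ge, if_neg hz.not_ge,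
    if_neg hzx.not_gt, if_pos hxy]
  ring_nf

theorem jointCDF_one_eq_F (hW : IsBrownianReal W P) (x y z : ℝ) :
    jointCDF W P 1 x y z = F x y z := by
  wlog hxy : x ≤ y generalizing x
  · rw [← jointCDF_one_min hW, ← F_min, this _ (min_le_right x y)]
  rcases le_or_gt y 0 with hy | hy
  · rw [jointCDF_one_of_nonpos hW hy, F, if_pos hy]
  by_cases h : 0 ≤ z ∨ x < z
  · rw [jointCDF_one_of_nonneg_or_lt hW hy hxy h, F_of_le_of_nonneg_or_lt hy hxy h]
  · obtain ⟨hz, hzx⟩ : z < 0 ∧ z ≤ x := by simpa using h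
    rw [jointCDF_one_of_pos hW hy, measureReal_le_and_runMax_lt hW hy hxy,
      measureReal_le_and_runMax_lt_and_lt_runMin hW hz hy hzx hxy, F_of_neg_of_le hz hy hzx hxy]

variable {t : ℝ≥0}

lemma image_rescale_Icc (ht : t ≠ 0) (a : ℝ) (w : ℝ≥0 → ℝ) :
    (fun s => a * w (t * s)) '' Icc 0 1 = a • (w '' Icc 0 t) := by
  ext v
  simp only [mem_image, mem_smul_set, exists_exists_and_eq_and, smul_eq_mul]
  constructor
  · rintro ⟨s, hs, rfl⟩
    exact ⟨t * s, ⟨zero_le, mul_le_of_le_one_right' hs.2⟩, rfl⟩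
  · rintro ⟨s, hs, rfl⟩
    exact ⟨t⁻¹ * s, ⟨zero_le, (inv_mul_le_one₀ (pos_of_ne_zero ht)).2 hs.2⟩, by
      rw [mul_inv_cancel_left₀ ht]⟩

lemma jointCDF_eq_jointCDF_one (hW : IsBrownianReal W P) (ht : t ≠ 0) (x y z : ℝ) :
    jointCDF W P t x y z = jointCDF (fun s ω => (√t)⁻¹ * W (t * s) ω) P 1
      (x / √t) (y / √t) (z / √t) := by
  have hpos : 0 < (√t)⁻¹ := by positivity
  rw [jointCDF_eq_measureReal hW, jointCDF_eq_measureReal (hW.smul ht)]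
  have hmax ω : runMax (fun s ω => (√t)⁻¹ * W (t * s) ω) 1 ω = (√t)⁻¹ * runMax W t ω := by
    rw [runMax, image_rescale_Icc ht _ (W · ω), Real.sSup_smul_of_nonneg hpos.le, smul_eq_mul,
      runMax]
  have hmin ω : runMin (fun s ω => (√t)⁻¹ * W (t * s) ω) 1 ω = (√t)⁻¹ * runMin W t ω := by
    rw [runMin, image_rescale_Icc ht _ (W · ω), Real.sInf_smul_of_nonneg hpos.le, smul_eq_mul,
      runMin]
  simp only [hmax, hmin, mul_one, div_eq_inv_mul, mul_le_mul_iff_right₀ hpos]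

theorem jointCDF_eq_F (hW : IsBrownianReal W P) (ht : t ≠ 0) (x y z : ℝ) :
    jointCDF W P t x y z = F (x / √t) (y / √t) (z / √t) := by
  rw [jointCDF_eq_jointCDF_one hW ht, jointCDF_one_eq_F (hW.smul ht)]

end JointCDF

end WienerExtrema

theorem theorem1 {Ω : Type*} [MeasurableSpace Ω] (P : Measure Ω) [IsProbabilityMeasure P]
    (W : ℝ≥0 → Ω → ℝ) (hW : IsBrownianReal W P) :
    (∀ q r s : ℝ, 0 < s → Summable (WienerExtrema.psiTerm q r s)) ∧
    ∀ t : ℝ≥0, 0 < t →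
      AEMeasurable (fun ω => (W t ω, WienerExtrema.runMax W t ω, WienerExtrema.runMin W t ω)) P ∧
      ∀ x y z : ℝ,
        WienerExtrema.jointCDF W P t x y z =
          WienerExtrema.F (x / √(t : ℝ)) (y / √(t : ℝ)) (z / √(t : ℝ)) :=
  ⟨fun q r _ hs => WienerExtrema.summable_psiTerm q r hs, fun t ht =>
    ⟨WienerExtrema.aemeasurable_prod_runMax_runMin hW t, WienerExtrema.jointCDF_eq_F hW ht.ne'⟩⟩
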